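/- Let $\mathbb D$ be the open unit disk in $\mathbb C$ and let $\mathcal A$ be a commutative unital complex Banach algebra with $\|1_{\mathcal A}\|=1$. Let $\{F_t\}_{t\ge 0}$ be a one-parameter continuous semigroup of holomorphic self-mappings of $\mathbb D$: $(t,z)\mapsto F_t(z)$ is continuous on $[0,\infty)\times\mathbb D$, $F_{t+s}=F_t\circ F_s$ for all $t,s\ge0$, and $F_0(z)=z$. Suppose that $z_0\in\mathbb D$ is an attractive fixed point, i.e. $F_t(z_0)=z_0$ for all $t\ge 0$ and $F_t(z)\to z_0$ as $t\to\infty$ for all $z$ in some neighbourhood of $z_0$. Let $\{\Gamma_t\}_{t\ge0}$ be an $\mathcal A$-valued semicocycle over $\{F_t\}$: each $\Gamma_t:\mathbb D\to\mathcal A$ is holomorphic, $(t,z)\mapsto\Gamma_t(z)$ is continuous on $[0,\infty)\times\mathbb D$, $\Gamma_t(F_s(z))\Gamma_s(z)=\Gamma_{t+s}(z)$ for all $t,s\ge 0$ and $z\in\mathbb D$, and $\Gamma_0(z)=1_{\mathcal A}$. Then the (one-sided) derivative $B(z)=\frac{d}{dt}\Gamma_t(z)\big|_{t=0}$ exists for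 every $z\in\mathbb D$; with $B_0=B(z_0)$ the integral in $$M(z)=\exp\left[\int_0^\infty\bigl(B(F_t(z))-B_0\bigr)\,dt\right]$$ converges absolutely for every $z\in\mathbb D$; the mapping $M$ is holomorphic on all of $\mathbb D$ with invertible values; and $$\Gamma_t(z)=M(F_t(z))^{-1}e^{tB_0}M(z)\qquad\text{for all } t\ge0,\ z\in\mathbb D .$$ In particular, every such semicocycle is linearizable. -/

import Mathlib

open Set Filter Topology MeasureTheory

noncomputable section

namespace HolSemicocycle

/-- The open unit disk of the complex plane. -/
def disk : Set ℂ := Metric.ball (0 : ℂ) 1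

/-- A one-parameter continuous semigroup of holomorphic self-mappings of the unit disk.
Only the values `F t z` with `0 ≤ t` and `z ∈ disk` matter. -/
structure IsSemigroup (F : ℝ → ℂ → ℂ) : Prop where
  mapsTo : ∀ t, 0 ≤ t → MapsTo (F t) disk disk
  holomorphic : ∀ t, 0 ≤ t → DifferentiableOn ℂ (F t) disk
  continuous : ContinuousOn (fun p : ℝ × ℂ => F p.1 p.2) (Ici 0 ×ˢ disk)
  add : ∀ t s, 0 ≤ t → 0 ≤ s → ∀ z ∈ disk, F (t + s) z = F t (F s z)
  zero : ∀ z ∈ disk, F 0 z = z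

/-- A holomorphic semicocycle, with values in the algebra `A`, over the family `F`. -/
structure IsSemicocycle {A : Type*} [NormedRing A] [NormedAlgebra ℂ A]
    (F : ℝ → ℂ → ℂ) (Γ : ℝ → ℂ → A) : Prop where
  holomorphic : ∀ t, 0 ≤ t → DifferentiableOn ℂ (Γ t) disk
  continuous : ContinuousOn (fun p : ℝ × ℂ => Γ p.1 p.2) (Ici 0 ×ˢ disk)
  chain : ∀ t s, 0 ≤ t → 0 ≤ s → ∀ z ∈ disk, Γ t (F s z) * Γ s z = Γ (t + s) z
  zero : ∀ z ∈ disk, Γ 0 z = 1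

/-- `z₀` is an attractive interior fixed point: it is a common fixed point in the disk, and the
trajectories of all points near `z₀` converge to `z₀`. (For semigroups on the disk this is
the same as convergence of all trajectories, and as `Re f'(z₀) < 0` for the generator `f`.) -/
structure IsAttractiveFixedPoint (F : ℝ → ℂ → ℂ) (z₀ : ℂ) : Prop where
  mem : z₀ ∈ disk
  fixed : ∀ t, 0 ≤ t → F t z₀ = z₀
  attractive : ∀ᶠ z in 𝓝 z₀, Tendsto (fun t : ℝ => F t z) atTop (𝓝 z₀)

variable {A : Type*} [NormedRing A] [NormedAlgebra ℂ A]

/-- `B(z) = d/dt Γ_t(z)` at `t = 0`, a one-sided derivative since `t` ranges over `[0, ∞)`. -/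
def generator (Γ : ℝ → ℂ → A) (z : ℂ) : A :=
  derivWithin (fun t : ℝ => Γ t z) (Ici 0) 0

/-- `M(z) = exp ∫_0^∞ (B(F_t(z)) - B(z₀)) dt`. -/
def transferMap (F : ℝ → ℂ → ℂ) (B : ℂ → A) (z₀ : ℂ) (z : ℂ) : A :=
  NormedSpace.exp (∫ t in Ioi (0 : ℝ), (B (F t z) - B z₀))

/-- The pair `M`, `B₀` linearizes `Γ`: the map `M` is holomorphic on the disk with invertible
values, and `Γ_t(z) = M(F_t(z))⁻¹ e^{t B₀} M(z)`. -/
structure IsLinearization (F : ℝ → ℂ → ℂ) (Γ : ℝ → ℂ → A) (M : ℂ → A) (B₀ : A) : Prop where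
  holomorphic : DifferentiableOn ℂ M disk
  isUnit : ∀ z ∈ disk, IsUnit (M z)
  eq : ∀ t, 0 ≤ t → ∀ z ∈ disk,
    Γ t z = Ring.inverse (M (F t z)) * NormedSpace.exp ((t : ℂ) • B₀) * M z

end HolSemicocycle

end

/-!
For a semigroup `F` and a semicocycle `Γ`, composing the averages `∫₀^τ F_s ds` and `∫₀^τ Γ_s ds`
with the flow only shifts the interval of integration, so both become differentiable in time
without any differentiability assumption on `F` or `Γ`. For small `τ` the first average has nonzero
derivative at a given point and the second has an invertible value, and the derivative passes to
`F` and `Γ`; the identities obtained this way also show that the generators are holomorphic.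

The strict Schwarz lemma at `z₀`, in the pseudo-hyperbolic distance, makes `F_t` converge to `z₀`
exponentially fast, uniformly on compact sets. Hence `∫₀^∞ (B(F_t z) - B(z₀)) dt` converges and is
holomorphic in `z`. The equation `∂ₜ Γ_t(z) = B(F_t z) Γ_t(z)` gives, by commutativity,
`Γ_t(z) = exp ∫₀ᵗ B(F_s z) ds`, and splitting the integral over `[0, ∞)` at `t` is the
linearization.
-/

namespace HolSemicocycle

open ComplexConjugate

section ParametricIntegral

lemma aestronglyMeasurable_deriv_of_eventually {𝕜 E α : Type*} [NontriviallyNormedField 𝕜]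
    [NormedAddCommGroup E] [NormedSpace 𝕜 E] [MeasurableSpace α] {μ : Measure α}
    {G : 𝕜 → α → E} {z : 𝕜} (hmeas : ∀ᶠ w in 𝓝 z, AEStronglyMeasurable (G w) μ)
    (hdiff : ∀ᵐ a ∂μ, DifferentiableAt 𝕜 (fun w => G w a) z) :
    AEStronglyMeasurable (fun a => deriv (fun w => G w a) z) μ := by
  classical
  refine aestronglyMeasurable_of_tendsto_ae (𝓝[≠] z)
    (f := fun w a => if AEStronglyMeasurable (G w) μ then slope (fun w => G w a) z w else 0)
    (fun w => ?_) ?_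
  · by_cases hw : AEStronglyMeasurable (G w) μ
    · simp only [hw, if_true, slope_def_module]
      exact (hw.sub hmeas.self_of_nhds).const_smul _
    · simp only [hw, if_false]
      exact aestronglyMeasurable_const
  · filter_upwards [hdiff] with a ha
    refine (hasDerivAt_iff_tendsto_slope.1 ha.hasDerivAt).congr' ?_
    filter_upwards [nhdsWithin_le_nhds hmeas] with w hw
    simp only [hw, if_true]

variable {E : Type*} [NormedAddCommGroup E] [NormedSpace ℂ E]

lemma norm_deriv_le_of_mem_ball_half {f : ℂ → E} {z w : ℂ} {R C : ℝ}
    (hf : DifferentiableOn ℂ f (Metric.closedBall z R))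
    (hC : ∀ u ∈ Metric.closedBall z R, ‖f u‖ ≤ C) (hw : w ∈ Metric.ball z (R / 2)) :
    ‖deriv f w‖ ≤ C / (R / 2) := by
  have hsub : Metric.closedBall w (R / 2) ⊆ Metric.closedBall z R :=
    Metric.closedBall_subset_closedBall' (by linarith [Metric.mem_ball.1 hw])
  exact Complex.norm_deriv_le_of_forall_mem_sphere_norm_le (Metric.pos_of_mem_ball hw)
    ((hf.mono hsub).diffContOnCl_ball subset_rfl)
    fun u hu => hC u (hsub (Metric.sphere_subset_closedBall hu))

lemma differentiableOn_integral_of_dominated_on_compacts {α : Type*} [MeasurableSpace α]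
    {μ : Measure α} {U : Set ℂ} (hU : IsOpen U) {G : ℂ → α → E}
    (hmeas : ∀ z ∈ U, AEStronglyMeasurable (G z) μ)
    (hdiff : ∀ᵐ a ∂μ, DifferentiableOn ℂ (fun z => G z a) U)
    (hbound : ∀ K ⊆ U, IsCompact K → ∃ b : α → ℝ, Integrable b μ ∧
      ∀ᵐ a ∂μ, ∀ w ∈ K, ‖G w a‖ ≤ b a) :
    DifferentiableOn ℂ (fun z => ∫ a, G z a ∂μ) U := by
  intro z hz
  have hzU := hU.mem_nhds hz
  obtain ⟨R, hR, hsub⟩ := Metric.nhds_basis_closedBall.mem_iff.1 hzU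
  obtain ⟨b, hb, hle⟩ := hbound _ hsub (isCompact_closedBall z R)
  have hball : Metric.ball z (R / 2) ⊆ U :=
    ((Metric.ball_subset_ball (half_le_self hR.le)).trans Metric.ball_subset_closedBall).trans hsub
  refine DifferentiableAt.differentiableWithinAt
    (hasDerivAt_integral_of_dominated_loc_of_deriv_le (F' := fun w a => deriv (fun w => G w a) w)
      (bound := fun a => b a / (R / 2)) (Metric.ball_mem_nhds z (half_pos hR))
      (mem_of_superset hzU hmeas) ?_ ?_ ?_ (hb.div_const _) ?_).2.differentiableAt
  · exact hb.mono' (hmeas z hz) (hle.mono fun a ha => ha z (Metric.mem_closedBall_self hR.le))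
  · exact aestronglyMeasurable_deriv_of_eventually (mem_of_superset hzU hmeas)
      (hdiff.mono fun a ha => ha.differentiableAt hzU)
  · filter_upwards [hle, hdiff] with a hle hdiff w hw
    exact norm_deriv_le_of_mem_ball_half (hdiff.mono hsub) hle hw
  · filter_upwards [hdiff] with a ha w hw
    exact (ha.differentiableAt (hU.mem_nhds (hball hw))).hasDerivAt

end ParametricIntegral

section RightDerivative

variable {E : Type*} [NormedAddCommGroup E] [NormedSpace ℝ E] [CompleteSpace E]

lemma hasDerivWithinAt_integral_Ici {g : ℝ → E} {a b : ℝ} (hg : ContinuousOn g (Ici a))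
    (hab : a ≤ b) : HasDerivWithinAt (fun h => ∫ s in a..h, g s) (g b) (Ici b) b := by
  refine intervalIntegral.integral_hasDerivWithinAt_right (t := Ioi b) ?_ ?_
    ((hg b hab).mono (Ioi_subset_Ici hab))
  · exact (hg.mono fun s hs => le_trans (le_min le_rfl hab) hs.1).intervalIntegrable
  · exact ⟨Ioi b, self_mem_nhdsWithin,
      (hg.mono (Ioi_subset_Ici hab)).aestronglyMeasurable measurableSet_Ioi⟩

lemma hasDerivWithinAt_integral_add {g : ℝ → E} (hg : ContinuousOn g (Ici 0)) {τ : ℝ}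
    (hτ : 0 ≤ τ) :
    HasDerivWithinAt (fun h => ∫ s in h..τ + h, g s) (g τ - g 0) (Ici 0) 0 := by
  have hright : HasDerivWithinAt (fun h => ∫ s in (0 : ℝ)..τ + h, g s) (g τ) (Ici 0) 0 := by
    have hshift : HasDerivWithinAt (fun h : ℝ => τ + h) 1 (Ici 0) 0 :=
      ((hasDerivAt_id (0 : ℝ)).const_add τ).hasDerivWithinAt
    simpa [Function.comp_def] using HasDerivWithinAt.scomp_of_eq (t' := Ici τ) (0 : ℝ)
      (hasDerivWithinAt_integral_Ici hg hτ) hshift (fun h (hh : 0 ≤ h) => by simpa using hh)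
      (by simp)
  have hint : ∀ b, 0 ≤ b → IntervalIntegrable g volume 0 b := fun b hb =>
    (hg.mono fun s hs => le_trans (le_min le_rfl hb) hs.1).intervalIntegrable
  refine (hright.sub (hasDerivWithinAt_integral_Ici hg le_rfl)).congr_of_mem (fun h hh => ?_)
    self_mem_Ici
  exact (intervalIntegral.integral_interval_sub_left (hint _ (add_nonneg hτ hh)) (hint _ hh)).symm

lemma differentiableWithinAt_of_comp_left {I : ℂ → ℂ} {φ : ℝ → ℂ} {s : Set ℝ} {x : ℝ}
    (hx : x ∈ s) (hφ : ContinuousWithinAt φ s x) (hI : DifferentiableAt ℂ I (φ x))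
    (hI0 : deriv I (φ x) ≠ 0) (hD : DifferentiableWithinAt ℝ (fun h => I (φ h)) s x) :
    DifferentiableWithinAt ℝ φ s x := by
  have hI' := (hI.hasDerivAt.hasFDerivAt.restrictScalars ℝ).hasFDerivWithinAt (s := univ)
  refine (hI'.of_comp_of_leftInverse (by simpa using hφ.tendsto) hD.hasFDerivWithinAt .rfl
    (f'symm := (ContinuousLinearMap.toSpanSingleton ℂ (deriv I (φ x))⁻¹).restrictScalars ℝ)
    (fun v => ?_) hx).differentiableWithinAt
  simp [hI0]

lemma differentiableWithinAt_of_isUnit_mul {A : Type*} [NormedRing A] [NormedAlgebra ℝ A]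
    [HasSummableGeomSeries A] {f g : ℝ → A} {s : Set ℝ} {x : ℝ} (hx : x ∈ s)
    (hf : DifferentiableWithinAt ℝ f s x) (hu : IsUnit (f x))
    (hfg : DifferentiableWithinAt ℝ (fun y => f y * g y) s x) :
    DifferentiableWithinAt ℝ g s x := by
  refine ((hf.inverse hu).mul hfg).congr_of_eventuallyEq_of_mem ?_ hx
  filter_upwards [hf.continuousWithinAt (Units.isOpen.mem_nhds hu)] with y hy
  exact (Ring.inverse_mul_cancel_left _ _ hy).symm

lemma eq_exp_integral_mul_of_hasDerivWithinAt {A : Type*} [NormedCommRing A] [NormedAlgebra ℝ A]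
    [CompleteSpace A] {g u : ℝ → A} {a : ℝ} (hg : ContinuousOn g (Ici a))
    (hu : ContinuousOn u (Ici a))
    (hderiv : ∀ t, a ≤ t → HasDerivWithinAt u (g t * u t) (Ici t) t) {t : ℝ} (ht : a ≤ t) :
    u t = NormedSpace.exp (∫ s in a..t, g s) * u a := by
  let _ : NormedAlgebra ℚ A := NormedAlgebra.restrictScalars ℚ ℝ A
  set P : ℝ → A := fun x => ∫ s in a..x, g s
  have hPcont : ContinuousOn P (Icc a t) := by
    rw [← uIcc_of_le ht]
    refine intervalIntegral.continuousOn_primitive_interval ?_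
    rw [uIcc_of_le ht]
    exact (hg.mono Icc_subset_Ici_self).integrableOn_compact isCompact_Icc
  have hcont : ContinuousOn (fun x => NormedSpace.exp (-P x) * u x) (Icc a t) :=
    (NormedSpace.exp_continuous.comp_continuousOn hPcont.neg).mul (hu.mono Icc_subset_Ici_self)
  have hzero : ∀ x ∈ Ico a t,
      HasDerivWithinAt (fun x => NormedSpace.exp (-P x) * u x) 0 (Ici x) x := by
    intro x hx
    have hexp : HasDerivWithinAt (fun x => NormedSpace.exp (-P x))
        (NormedSpace.exp (-P x) * -g x) (Ici x) x := by
      simpa [Function.comp_def] using (hasFDerivAt_exp (𝕂 := ℝ) (x := -P x)).comp_hasDerivWithinAt x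
        (hasDerivWithinAt_integral_Ici hg hx.1).neg
    convert! hexp.mul (hderiv x hx.1) using 1
    ring
  have hconst : NormedSpace.exp (-P t) * u t = u a := by
    simpa [P] using constant_of_has_deriv_right_zero hcont hzero t ⟨ht, le_rfl⟩
  rw [← hconst, ← mul_assoc, ← NormedSpace.exp_add, add_neg_cancel, NormedSpace.exp_zero, one_mul]

end RightDerivative

section TimeIntegral

variable {E : Type*} [NormedAddCommGroup E]

/-- The time average `∫ s in 0..τ, G s z` of a family of maps, not normalized by `τ`. It depends
on `z` as regularly as the maps `G s` do, while composing with the flow only shifts the interval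
of integration. -/
noncomputable def timeIntegral [NormedSpace ℝ E] (G : ℝ → ℂ → E) (τ : ℝ) (z : ℂ) : E :=
  ∫ s in (0 : ℝ)..τ, G s z

variable {G : ℝ → ℂ → E} {U : Set ℂ}

lemma continuousOn_time (hG : ContinuousOn (fun p : ℝ × ℂ => G p.1 p.2) (Ici 0 ×ˢ U)) {z : ℂ}
    (hz : z ∈ U) : ContinuousOn (fun s => G s z) (Ici 0) :=
  hG.comp (continuousOn_id.prodMk continuousOn_const) fun _ hs => ⟨hs, hz⟩

lemma intervalIntegrable_time (hG : ContinuousOn (fun p : ℝ × ℂ => G p.1 p.2) (Ici 0 ×ˢ U))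
    {z : ℂ} (hz : z ∈ U) {τ : ℝ} (hτ : 0 ≤ τ) :
    IntervalIntegrable (fun s => G s z) volume 0 τ :=
  ((continuousOn_time hG hz).mono fun _ hs => le_trans (le_min le_rfl hτ) hs.1).intervalIntegrable

lemma differentiableOn_timeIntegral [NormedSpace ℂ E] (hU : IsOpen U)
    (hG : ContinuousOn (fun p : ℝ × ℂ => G p.1 p.2) (Ici 0 ×ˢ U))
    (hd : ∀ t, 0 ≤ t → DifferentiableOn ℂ (G t) U) {τ : ℝ} (hτ : 0 ≤ τ) :
    DifferentiableOn ℂ (timeIntegral G τ) U := by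
  unfold timeIntegral
  simp only [intervalIntegral.integral_of_le hτ]
  refine differentiableOn_integral_of_dominated_on_compacts hU (fun z hz => ?_) ?_
    fun K hKU hK => ?_
  · exact ((continuousOn_time hG hz).mono fun s hs => hs.1.le).aestronglyMeasurable
      measurableSet_Ioc
  · exact ae_restrict_of_forall_mem measurableSet_Ioc fun s hs => hd s hs.1.le
  · obtain ⟨C, hC⟩ := (isCompact_Icc.prod hK).exists_bound_of_continuousOn
      (hG.mono (prod_mono (Icc_subset_Ici_self : Icc 0 τ ⊆ Ici 0) hKU))
    exact ⟨fun _ => C, integrable_const _, ae_restrict_of_forall_mem measurableSet_Ioc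
      fun s hs w hw => hC (s, w) ⟨⟨hs.1.le, hs.2⟩, hw⟩⟩

lemma exists_norm_timeIntegral_sub_le [NormedSpace ℝ E] [CompleteSpace E]
    (hG : ContinuousOn (fun p : ℝ × ℂ => G p.1 p.2) (Ici 0 ×ˢ U)) {K : Set ℂ} (hK : IsCompact K)
    (hKU : K ⊆ U) {ε : ℝ} (hε : 0 < ε) :
    ∃ τ > 0, ∀ z ∈ K, ‖timeIntegral G τ z - τ • G 0 z‖ ≤ ε * τ := by
  obtain ⟨τ, hτ, hclose⟩ : ∃ τ > 0, ∀ s ∈ Icc 0 τ, ∀ z ∈ K, ‖G s z - G 0 z‖ < ε := by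
    obtain ⟨v, hv, hvK⟩ := hK.mem_uniformity_of_prod (hG.mono (prod_mono_right hKU))
      self_mem_Ici (Metric.dist_mem_uniformity hε)
    obtain ⟨τ, hτ, hsub⟩ := mem_nhdsGE_iff_exists_Icc_subset.1 hv
    exact ⟨τ, hτ, fun s hs z hz => dist_eq_norm (G s z) _ ▸ hvK s (hsub hs) z hz⟩
  refine ⟨τ, hτ, fun z hz => ?_⟩
  have hsub : timeIntegral G τ z - τ • G 0 z = ∫ s in (0 : ℝ)..τ, (G s z - G 0 z) := by
    rw [intervalIntegral.integral_sub (intervalIntegrable_time hG (hKU hz) hτ.le)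
      intervalIntegrable_const, intervalIntegral.integral_const, sub_zero, timeIntegral]
  rw [hsub]
  simpa only [sub_zero, abs_of_pos hτ] using
    intervalIntegral.norm_integral_le_of_norm_le_const (a := 0) (b := τ) fun s hs =>
      (hclose s ((uIoc_subset_uIcc.trans (uIcc_of_le hτ.le).le) hs) z hz).le

end TimeIntegral

lemma isOpen_disk : IsOpen disk := Metric.isOpen_ball

lemma mem_disk {z : ℂ} : z ∈ disk ↔ ‖z‖ < 1 := mem_ball_zero_iff

section SemigroupGenerator

variable {F : ℝ → ℂ → ℂ}

lemma IsSemigroup.differentiableOn_timeIntegral (hF : IsSemigroup F) {τ : ℝ} (hτ : 0 ≤ τ) :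
    DifferentiableOn ℂ (timeIntegral F τ) disk :=
  HolSemicocycle.differentiableOn_timeIntegral isOpen_disk hF.continuous hF.holomorphic hτ

lemma IsSemigroup.timeIntegral_comp (hF : IsSemigroup F) {τ h : ℝ} (hτ : 0 ≤ τ) (hh : 0 ≤ h)
    {z : ℂ} (hz : z ∈ disk) : timeIntegral F τ (F h z) = ∫ s in h..τ + h, F s z := by
  calc timeIntegral F τ (F h z) = ∫ s in (0 : ℝ)..τ, F (s + h) z := by
        refine intervalIntegral.integral_congr fun s hs => ?_
        rw [uIcc_of_le hτ] at hs
        exact (hF.add s h hs.1 hh z hz).symm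
    _ = ∫ s in h..τ + h, F s z := by
        rw [intervalIntegral.integral_comp_add_right (fun s => F s z), zero_add]

lemma IsSemigroup.hasDerivWithinAt_timeIntegral_comp (hF : IsSemigroup F) {τ : ℝ} (hτ : 0 ≤ τ)
    {z : ℂ} (hz : z ∈ disk) :
    HasDerivWithinAt (fun h => timeIntegral F τ (F h z)) (F τ z - z) (Ici 0) 0 := by
  have hwindow := hasDerivWithinAt_integral_add (continuousOn_time hF.continuous hz) hτ
  rw [hF.zero z hz] at hwindow
  exact hwindow.congr_of_mem (fun h hh => hF.timeIntegral_comp hτ hh hz) self_mem_Ici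

lemma IsSemigroup.exists_deriv_timeIntegral_ne_zero (hF : IsSemigroup F) {z : ℂ}
    (hz : z ∈ disk) : ∃ τ > 0, deriv (timeIntegral F τ) z ≠ 0 := by
  have hnhds := isOpen_disk.mem_nhds hz
  obtain ⟨r, hr, hsub⟩ := Metric.nhds_basis_closedBall.mem_iff.1 hnhds
  obtain ⟨τ, hτ, hclose⟩ := exists_norm_timeIntegral_sub_le hF.continuous
    (isCompact_closedBall z r) hsub (half_pos hr)
  have hI := hF.differentiableOn_timeIntegral hτ.le
  have hderiv : deriv (fun w => timeIntegral F τ w - τ * w) z = deriv (timeIntegral F τ) z - τ := by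
    simpa using ((hI.differentiableAt hnhds).hasDerivAt.fun_sub
      ((hasDerivAt_id' z).const_mul (τ : ℂ))).deriv
  have hcauchy : ‖deriv (timeIntegral F τ) z - τ‖ ≤ τ / 2 := by
    rw [← hderiv, show τ / 2 = r / 2 * τ / r by field_simp]
    refine Complex.norm_deriv_le_of_forall_mem_sphere_norm_le hr
      (((hI.sub (differentiableOn_id.const_mul _)).mono hsub).diffContOnCl_ball subset_rfl)
      fun w hw => ?_
    have hw' := Metric.sphere_subset_closedBall hw
    simpa only [hF.zero w (hsub hw'), Complex.real_smul] using hclose w hw'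
  refine ⟨τ, hτ, fun h0 => ?_⟩
  rw [h0, zero_sub, norm_neg, Complex.norm_real, Real.norm_of_nonneg hτ.le] at hcauchy
  linarith

lemma IsSemigroup.hasDerivWithinAt_generator (hF : IsSemigroup F) {z : ℂ} (hz : z ∈ disk) :
    HasDerivWithinAt (fun t => F t z) (generator F z) (Ici 0) 0 := by
  obtain ⟨τ, hτ, h0⟩ := hF.exists_deriv_timeIntegral_ne_zero hz
  refine (differentiableWithinAt_of_comp_left (I := timeIntegral F τ) self_mem_Ici
    (continuousOn_time hF.continuous hz 0 self_mem_Ici) ?_ ?_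
    (hF.hasDerivWithinAt_timeIntegral_comp hτ.le hz).differentiableWithinAt).hasDerivWithinAt
  · rw [hF.zero z hz]
    exact (hF.differentiableOn_timeIntegral hτ.le).differentiableAt (isOpen_disk.mem_nhds hz)
  · rwa [hF.zero z hz]

lemma IsSemigroup.hasDerivWithinAt_comp (hF : IsSemigroup F) {E : Type*} [NormedAddCommGroup E]
    [NormedSpace ℂ E] {H : ℂ → E} (hH : DifferentiableOn ℂ H disk) {z : ℂ} (hz : z ∈ disk) :
    HasDerivWithinAt (fun t => H (F t z)) (generator F z • deriv H z) (Ici 0) 0 :=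
  HasDerivAt.scomp_hasDerivWithinAt_of_eq (0 : ℝ)
    (hH.differentiableAt (isOpen_disk.mem_nhds hz)).hasDerivAt (hF.hasDerivWithinAt_generator hz)
    (hF.zero z hz).symm

lemma IsSemigroup.generator_mul_deriv_timeIntegral (hF : IsSemigroup F) {τ : ℝ} (hτ : 0 ≤ τ)
    {z : ℂ} (hz : z ∈ disk) : generator F z * deriv (timeIntegral F τ) z = F τ z - z :=
  (uniqueDiffWithinAt_Ici 0).eq_deriv _
    (hF.hasDerivWithinAt_comp (hF.differentiableOn_timeIntegral hτ) hz)
    (hF.hasDerivWithinAt_timeIntegral_comp hτ hz)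

lemma IsSemigroup.differentiableOn_generator (hF : IsSemigroup F) :
    DifferentiableOn ℂ (generator F) disk := by
  intro z hz
  have hnhds := isOpen_disk.mem_nhds hz
  obtain ⟨τ, hτ, h0⟩ := hF.exists_deriv_timeIntegral_ne_zero hz
  have hderiv : DifferentiableAt ℂ (deriv (timeIntegral F τ)) z :=
    ((hF.differentiableOn_timeIntegral hτ.le).deriv isOpen_disk).differentiableAt hnhds
  have hquot : DifferentiableAt ℂ (fun w => (F τ w - w) / deriv (timeIntegral F τ) w) z :=
    (((hF.holomorphic τ hτ.le).differentiableAt hnhds).sub differentiableAt_id).div hderiv h0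
  refine (hquot.congr_of_eventuallyEq ?_).differentiableWithinAt
  filter_upwards [hnhds, hderiv.continuousAt.eventually_ne h0] with w hw hw0
  exact eq_div_of_mul_eq hw0 (hF.generator_mul_deriv_timeIntegral hτ.le hw)

end SemigroupGenerator

section SemicocycleGenerator

variable {A : Type*} [NormedRing A] [NormedAlgebra ℂ A] {F : ℝ → ℂ → ℂ} {Γ : ℝ → ℂ → A}

lemma IsSemicocycle.differentiableOn_timeIntegral (hΓ : IsSemicocycle F Γ) {τ : ℝ}
    (hτ : 0 ≤ τ) : DifferentiableOn ℂ (timeIntegral Γ τ) disk :=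
  HolSemicocycle.differentiableOn_timeIntegral isOpen_disk hΓ.continuous hΓ.holomorphic hτ

variable [CompleteSpace A]

lemma IsSemicocycle.timeIntegral_comp_mul (hF : IsSemigroup F) (hΓ : IsSemicocycle F Γ)
    {τ h : ℝ} (hτ : 0 ≤ τ) (hh : 0 ≤ h) {z : ℂ} (hz : z ∈ disk) :
    timeIntegral Γ τ (F h z) * Γ h z = ∫ s in h..τ + h, Γ s z := by
  calc timeIntegral Γ τ (F h z) * Γ h z = ∫ s in (0 : ℝ)..τ, Γ s (F h z) * Γ h z :=
        (((ContinuousLinearMap.mul ℝ A).flip (Γ h z)).intervalIntegral_comp_comm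
          (intervalIntegrable_time hΓ.continuous (hF.mapsTo h hh hz) hτ)).symm
    _ = ∫ s in (0 : ℝ)..τ, Γ (s + h) z := by
        refine intervalIntegral.integral_congr fun s hs => ?_
        rw [uIcc_of_le hτ] at hs
        exact hΓ.chain s h hs.1 hh z hz
    _ = ∫ s in h..τ + h, Γ s z := by
        rw [intervalIntegral.integral_comp_add_right (fun s => Γ s z), zero_add]

lemma IsSemicocycle.hasDerivWithinAt_timeIntegral_comp_mul (hF : IsSemigroup F)
    (hΓ : IsSemicocycle F Γ) {τ : ℝ} (hτ : 0 ≤ τ) {z : ℂ} (hz : z ∈ disk) :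
    HasDerivWithinAt (fun h => timeIntegral Γ τ (F h z) * Γ h z) (Γ τ z - 1) (Ici 0) 0 := by
  have hwindow := hasDerivWithinAt_integral_add (continuousOn_time hΓ.continuous hz) hτ
  rw [hΓ.zero z hz] at hwindow
  exact hwindow.congr_of_mem (fun h hh => hΓ.timeIntegral_comp_mul hF hτ hh hz) self_mem_Ici

lemma IsSemicocycle.exists_isUnit_timeIntegral (hΓ : IsSemicocycle F Γ) {z : ℂ}
    (hz : z ∈ disk) : ∃ τ > 0, IsUnit (timeIntegral Γ τ z) := by
  obtain ⟨τ, hτ, hclose⟩ := exists_norm_timeIntegral_sub_le hΓ.continuous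
    (isCompact_singleton (x := z)) (singleton_subset_iff.2 hz) one_half_pos
  have hnorm : ‖1 - τ⁻¹ • timeIntegral Γ τ z‖ < 1 := by
    have hscale : 1 - τ⁻¹ • timeIntegral Γ τ z = τ⁻¹ • (τ • 1 - timeIntegral Γ τ z) := by
      rw [smul_sub, inv_smul_smul₀ hτ.ne']
    have hle := hclose z rfl
    rw [hΓ.zero z hz] at hle
    rw [hscale, norm_smul, norm_inv, Real.norm_of_nonneg hτ.le, norm_sub_rev,
      inv_mul_lt_iff₀ hτ]
    linarith
  have hunit : IsUnit (τ⁻¹ • timeIntegral Γ τ z) := by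
    simpa only [sub_sub_cancel] using isUnit_one_sub_of_norm_lt_one hnorm
  exact ⟨τ, hτ, (isUnit_smul_iff (Units.mk0 τ hτ.ne')⁻¹ _).1 hunit⟩

lemma IsSemicocycle.hasDerivWithinAt_generator (hF : IsSemigroup F) (hΓ : IsSemicocycle F Γ)
    {z : ℂ} (hz : z ∈ disk) :
    HasDerivWithinAt (fun t => Γ t z) (generator Γ z) (Ici 0) 0 := by
  obtain ⟨τ, hτ, hunit⟩ := hΓ.exists_isUnit_timeIntegral hz
  refine (differentiableWithinAt_of_isUnit_mul (f := fun t => timeIntegral Γ τ (F t z))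
    self_mem_Ici ?_ ?_ (hΓ.hasDerivWithinAt_timeIntegral_comp_mul hF hτ.le
      hz).differentiableWithinAt).hasDerivWithinAt
  · exact (hF.hasDerivWithinAt_comp (hΓ.differentiableOn_timeIntegral hτ.le)
      hz).differentiableWithinAt
  · rwa [hF.zero z hz]

lemma IsSemicocycle.timeIntegral_mul_generator (hF : IsSemigroup F) (hΓ : IsSemicocycle F Γ)
    {τ : ℝ} (hτ : 0 ≤ τ) {z : ℂ} (hz : z ∈ disk) :
    timeIntegral Γ τ z * generator Γ z =
      Γ τ z - 1 - generator F z • deriv (timeIntegral Γ τ) z := by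
  have hprod := (hF.hasDerivWithinAt_comp (hΓ.differentiableOn_timeIntegral hτ) hz).mul
    (hΓ.hasDerivWithinAt_generator hF hz)
  rw [hF.zero z hz, hΓ.zero z hz, mul_one] at hprod
  rw [← (uniqueDiffWithinAt_Ici 0).eq_deriv _ hprod
    (hΓ.hasDerivWithinAt_timeIntegral_comp_mul hF hτ hz), add_sub_cancel_left]

lemma IsSemicocycle.differentiableOn_generator (hF : IsSemigroup F) (hΓ : IsSemicocycle F Γ) :
    DifferentiableOn ℂ (generator Γ) disk := by
  intro z hz
  have hnhds := isOpen_disk.mem_nhds hz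
  obtain ⟨τ, hτ, hunit⟩ := hΓ.exists_isUnit_timeIntegral hz
  have hJ := hΓ.differentiableOn_timeIntegral hτ.le
  have hJz := hJ.differentiableAt hnhds
  have hquot : DifferentiableAt ℂ (fun w => Ring.inverse (timeIntegral Γ τ w) *
      (Γ τ w - 1 - generator F w • deriv (timeIntegral Γ τ) w)) z :=
    (hJz.inverse hunit).mul ((((hΓ.holomorphic τ hτ.le).differentiableAt hnhds).sub_const 1).sub
      ((hF.differentiableOn_generator.differentiableAt hnhds).smul
        ((hJ.deriv isOpen_disk).differentiableAt hnhds)))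
  refine (hquot.congr_of_eventuallyEq ?_).differentiableWithinAt
  filter_upwards [hnhds, hJz.continuousAt (Units.isOpen.mem_nhds hunit)] with w hw hwunit
  rw [← hΓ.timeIntegral_mul_generator hF hτ.le hw, Ring.inverse_mul_cancel_left _ _ hwunit]

end SemicocycleGenerator

section DiskGeometry

/-- The automorphism of the disk that exchanges `0` and `a`. Its modulus at `w` is the
pseudo-hyperbolic distance between `a` and `w`. -/
noncomputable def diskInvolution (a w : ℂ) : ℂ := (a - w) / (1 - conj a * w)

@[simp] lemma diskInvolution_zero (a : ℂ) : diskInvolution a 0 = a := by simp [diskInvolution]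

@[simp] lemma diskInvolution_self (a : ℂ) : diskInvolution a a = 0 := by simp [diskInvolution]

variable {a w : ℂ}

lemma one_sub_conj_mul_ne_zero (ha : a ∈ disk) (hw : w ∈ disk) : 1 - conj a * w ≠ 0 := by
  rw [mem_disk] at ha hw
  have hlt : ‖conj a * w‖ < 1 := by
    rw [norm_mul, RCLike.norm_conj]
    exact mul_lt_one_of_nonneg_of_lt_one_left (norm_nonneg _) ha hw.le
  rw [sub_ne_zero]
  rintro h
  rw [← h, norm_one] at hlt
  exact lt_irrefl _ hlt

lemma mapsTo_diskInvolution (ha : a ∈ disk) : MapsTo (diskInvolution a) disk disk := by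
  intro w hw
  have hden := norm_pos_iff.2 (one_sub_conj_mul_ne_zero ha hw)
  rw [mem_disk] at *
  rw [diskInvolution, norm_div, div_lt_one hden, ← sq_lt_sq₀ (norm_nonneg _) hden.le, ← sub_pos]
  have hid : ‖1 - conj a * w‖ ^ 2 - ‖a - w‖ ^ 2 = (1 - ‖a‖ ^ 2) * (1 - ‖w‖ ^ 2) := by
    simp only [Complex.sq_norm, Complex.normSq_apply, Complex.sub_re, Complex.sub_im,
      Complex.mul_re, Complex.mul_im, Complex.conj_re, Complex.conj_im, Complex.one_re,
      Complex.one_im]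
    ring
  rw [hid]
  exact mul_pos (sub_pos.2 (pow_lt_one₀ (norm_nonneg _) ha two_ne_zero))
    (sub_pos.2 (pow_lt_one₀ (norm_nonneg _) hw two_ne_zero))

lemma diskInvolution_diskInvolution (ha : a ∈ disk) (hw : w ∈ disk) :
    diskInvolution a (diskInvolution a w) = w := by
  have hden : 1 - w * conj a ≠ 0 := mul_comm (conj a) w ▸ one_sub_conj_mul_ne_zero ha hw
  rw [diskInvolution, div_eq_iff (one_sub_conj_mul_ne_zero ha (mapsTo_diskInvolution ha hw)),
    diskInvolution]
  field_simp
  ring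

lemma differentiableOn_diskInvolution (ha : a ∈ disk) :
    DifferentiableOn ℂ (diskInvolution a) disk := by
  intro w hw
  have hden := one_sub_conj_mul_ne_zero ha hw
  refine DifferentiableAt.differentiableWithinAt ?_
  unfold diskInvolution
  fun_prop (disch := assumption)

lemma exists_norm_le_mul_of_norm_ne {f : ℂ → ℂ} (hd : DifferentiableOn ℂ f disk)
    (hm : MapsTo f disk disk) (h0 : f 0 = 0) (hw : w ∈ disk) (hne : ‖f w‖ ≠ ‖w‖) {r : ℝ}
    (hr : r ∈ Ico 0 1) : ∃ q ∈ Ico (0 : ℝ) 1, ∀ z, ‖z‖ ≤ r → ‖f z‖ ≤ q * ‖z‖ := by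
  have hmul : ∀ z, ‖f z‖ = ‖z‖ * ‖dslope f 0 z‖ := fun z => by
    simpa [h0] using congrArg norm (sub_smul_dslope f 0 z).symm
  have hm' : MapsTo f (Metric.ball 0 1) (Metric.closedBall (f 0) 1) := by
    rw [h0]
    exact hm.mono_right Metric.ball_subset_closedBall
  have hsub : Metric.closedBall (0 : ℂ) r ⊆ disk := Metric.closedBall_subset_ball hr.2
  have hcont : ContinuousOn (dslope f 0) (Metric.closedBall 0 r) :=
    ((Complex.differentiableOn_dslope (Metric.ball_mem_nhds 0 one_pos)).2 hd).continuousOn.mono hsub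
  obtain ⟨z₁, hz₁, hmax⟩ := (isCompact_closedBall (0 : ℂ) r).exists_isMaxOn
    (Metric.nonempty_closedBall.2 hr.1) hcont.norm
  refine ⟨‖dslope f 0 z₁‖, ⟨norm_nonneg _, ?_⟩, fun z hz => ?_⟩
  · have hle := Complex.norm_dslope_le_div_of_mapsTo_ball hd hm' (hsub hz₁)
    refine (div_one (1 : ℝ) ▸ hle).lt_of_ne fun heq => hne ?_
    rw [Complex.affine_of_mapsTo_ball_of_norm_dslope_eq_div hd hm' (hsub hz₁)
      (by rw [heq, div_one]) hw]
    simp [h0, heq]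
  · rw [hmul, mul_comm]
    exact mul_le_mul_of_nonneg_right (hmax (mem_closedBall_zero_iff.2 hz)) (norm_nonneg _)

lemma norm_diskInvolution_le {f : ℂ → ℂ} (hd : DifferentiableOn ℂ f disk)
    (hm : MapsTo f disk disk) (ha : a ∈ disk) (hfa : f a = a) (hw : w ∈ disk) :
    ‖diskInvolution a (f w)‖ ≤ ‖diskInvolution a w‖ := by
  have hφ := differentiableOn_diskInvolution ha
  have hφm := mapsTo_diskInvolution ha
  have hle := Complex.norm_le_norm_of_mapsTo_ball (f := diskInvolution a ∘ f ∘ diskInvolution a)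
    (hφ.comp (hd.comp hφ hφm) (hm.comp hφm))
    ((hφm.comp (hm.comp hφm)).mono_right Metric.ball_subset_closedBall) (by simp [hfa])
    (mem_disk.1 (hφm hw))
  simpa [diskInvolution_diskInvolution ha hw] using hle

lemma exists_norm_diskInvolution_le_mul {f : ℂ → ℂ} (hd : DifferentiableOn ℂ f disk)
    (hm : MapsTo f disk disk) (ha : a ∈ disk) (hfa : f a = a) (hw : w ∈ disk)
    (hne : ‖diskInvolution a (f w)‖ ≠ ‖diskInvolution a w‖) {r : ℝ} (hr : r ∈ Ico 0 1) :
    ∃ q ∈ Ico (0 : ℝ) 1, ∀ z ∈ disk, ‖diskInvolution a z‖ ≤ r →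
      ‖diskInvolution a (f z)‖ ≤ q * ‖diskInvolution a z‖ := by
  have hφ := differentiableOn_diskInvolution ha
  have hφm := mapsTo_diskInvolution ha
  obtain ⟨q, hq, hle⟩ := exists_norm_le_mul_of_norm_ne
    (f := diskInvolution a ∘ f ∘ diskInvolution a) (hφ.comp (hd.comp hφ hφm) (hm.comp hφm))
    (hφm.comp (hm.comp hφm)) (by simp [hfa]) (hφm hw)
    (by simpa [diskInvolution_diskInvolution ha hw] using hne) hr
  exact ⟨q, hq, fun z hz hzr => by
    simpa [diskInvolution_diskInvolution ha hz] using hle (diskInvolution a z) hzr⟩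

lemma exists_norm_sub_le_mul_norm_diskInvolution {E : Type*} [NormedAddCommGroup E]
    [NormedSpace ℂ E] [CompleteSpace E] {B : ℂ → E} (hB : DifferentiableOn ℂ B disk)
    (ha : a ∈ disk) {r : ℝ} (hr : r ∈ Ico 0 1) :
    ∃ L ≥ 0, ∀ z ∈ disk, ‖diskInvolution a z‖ ≤ r → ‖B z - B a‖ ≤ L * ‖diskInvolution a z‖ := by
  have hcomp : DifferentiableOn ℂ (B ∘ diskInvolution a) disk :=
    hB.comp (differentiableOn_diskInvolution ha) (mapsTo_diskInvolution ha)
  have hcont : ContinuousOn (dslope (B ∘ diskInvolution a) 0) (Metric.closedBall 0 r) :=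
    ((Complex.differentiableOn_dslope (Metric.ball_mem_nhds 0 one_pos)).2 hcomp).continuousOn.mono
      (Metric.closedBall_subset_ball hr.2)
  obtain ⟨L, hL⟩ := (isCompact_closedBall (0 : ℂ) r).exists_bound_of_continuousOn hcont
  refine ⟨L, (norm_nonneg _).trans (hL 0 (Metric.mem_closedBall_self hr.1)), fun z hz hzr => ?_⟩
  have hslope : B z - B a =
      diskInvolution a z • dslope (B ∘ diskInvolution a) 0 (diskInvolution a z) := by
    simpa [diskInvolution_diskInvolution ha hz] using
      (sub_smul_dslope (B ∘ diskInvolution a) 0 (diskInvolution a z)).symm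
  rw [hslope, norm_smul, mul_comm]
  exact mul_le_mul_of_nonneg_right (hL _ (mem_closedBall_zero_iff.2 hzr)) (norm_nonneg _)

end DiskGeometry

section ExponentialConvergence

variable {F : ℝ → ℂ → ℂ} {z₀ : ℂ}

lemma IsSemigroup.apply_natCast_succ (hF : IsSemigroup F) (n : ℕ) {z : ℂ} (hz : z ∈ disk) :
    F (n + 1 : ℕ) z = F 1 (F n z) := by
  rw [Nat.cast_succ, add_comm, hF.add 1 n zero_le_one n.cast_nonneg z hz]

lemma IsAttractiveFixedPoint.exists_norm_diskInvolution_ne (hF : IsSemigroup F)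
    (hz₀ : IsAttractiveFixedPoint F z₀) :
    ∃ z ∈ disk, ‖diskInvolution z₀ (F 1 z)‖ ≠ ‖diskInvolution z₀ z‖ := by
  -- An isometry `F 1` would keep every orbit at a constant distance from `z₀`.
  by_contra! hiso
  have hiter : ∀ z ∈ disk, ∀ n : ℕ, ‖diskInvolution z₀ (F n z)‖ = ‖diskInvolution z₀ z‖ := by
    intro z hz n
    induction n with
    | zero => rw [Nat.cast_zero, hF.zero z hz]
    | succ n ih => rw [hF.apply_natCast_succ n hz, hiso _ (hF.mapsTo n n.cast_nonneg hz), ih]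
  have hnear : ∀ᶠ z in 𝓝[≠] z₀, Tendsto (fun t : ℝ => F t z) atTop (𝓝 z₀) ∧ z ∈ disk :=
    (hz₀.attractive.and (isOpen_disk.mem_nhds hz₀.mem)).filter_mono nhdsWithin_le_nhds
  obtain ⟨z, ⟨hconv, hz⟩, hne⟩ := (hnear.and eventually_mem_nhdsWithin).exists
  have hcont : ContinuousAt (diskInvolution z₀) z₀ :=
    (differentiableOn_diskInvolution hz₀.mem).continuousOn.continuousAt
      (isOpen_disk.mem_nhds hz₀.mem)
  have hlim : Tendsto (fun n : ℕ => ‖diskInvolution z₀ (F n z)‖) atTop (𝓝 0) := by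
    simpa [Function.comp_def] using
      (hcont.tendsto.comp (hconv.comp tendsto_natCast_atTop_atTop)).norm
  simp only [hiter z hz, tendsto_const_nhds_iff, norm_eq_zero] at hlim
  refine hne ?_
  rw [mem_singleton_iff, ← diskInvolution_diskInvolution hz₀.mem hz, hlim, diskInvolution_zero]

lemma IsAttractiveFixedPoint.exists_norm_diskInvolution_le_pow (hF : IsSemigroup F)
    (hz₀ : IsAttractiveFixedPoint F z₀) {r : ℝ} (hr : r ∈ Ico 0 1) :
    ∃ q ∈ Ico (0 : ℝ) 1, ∀ t, 0 ≤ t → ∀ z ∈ disk, ‖diskInvolution z₀ z‖ ≤ r →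
      ‖diskInvolution z₀ (F t z)‖ ≤ q ^ ⌊t⌋₊ * ‖diskInvolution z₀ z‖ := by
  obtain ⟨w, hw, hne⟩ := hz₀.exists_norm_diskInvolution_ne hF
  obtain ⟨q, hq, hstep⟩ := exists_norm_diskInvolution_le_mul (hF.holomorphic 1 zero_le_one)
    (hF.mapsTo 1 zero_le_one) hz₀.mem (hz₀.fixed 1 zero_le_one) hw hne hr
  refine ⟨q, hq, fun t ht z hz hzr => ?_⟩
  have hiter : ∀ n : ℕ, ‖diskInvolution z₀ (F n z)‖ ≤ q ^ n * ‖diskInvolution z₀ z‖ := by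
    intro n
    induction n with
    | zero => simp [hF.zero z hz]
    | succ n ih =>
      have hle : ‖diskInvolution z₀ (F n z)‖ ≤ r :=
        ih.trans ((mul_le_of_le_one_left (norm_nonneg _) (pow_le_one₀ hq.1 hq.2.le)).trans hzr)
      rw [hF.apply_natCast_succ n hz, pow_succ', mul_assoc]
      exact (hstep _ (hF.mapsTo n n.cast_nonneg hz) hle).trans (mul_le_mul_of_nonneg_left ih hq.1)
  have hfract : 0 ≤ t - ⌊t⌋₊ := sub_nonneg.2 (Nat.floor_le ht)
  calc ‖diskInvolution z₀ (F t z)‖ = ‖diskInvolution z₀ (F (t - ⌊t⌋₊) (F ⌊t⌋₊ z))‖ := by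
        rw [← hF.add _ _ hfract (Nat.cast_nonneg _) z hz, sub_add_cancel]
    _ ≤ ‖diskInvolution z₀ (F ⌊t⌋₊ z)‖ :=
        norm_diskInvolution_le (hF.holomorphic _ hfract) (hF.mapsTo _ hfract) hz₀.mem
          (hz₀.fixed _ hfract) (hF.mapsTo _ (Nat.cast_nonneg _) hz)
    _ ≤ q ^ ⌊t⌋₊ * ‖diskInvolution z₀ z‖ := hiter _

lemma pow_floor_le_exp {q : ℝ} (hq0 : 0 ≤ q) (hq1 : q ≤ 1) (t : ℝ) :
    q ^ ⌊t⌋₊ ≤ Real.exp (1 - q) * Real.exp (-(1 - q) * t) := by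
  have hq : q ≤ Real.exp (q - 1) := by linarith [Real.add_one_le_exp (q - 1)]
  refine (pow_le_pow_left₀ hq0 hq _).trans ?_
  rw [← Real.exp_nat_mul, ← Real.exp_add, Real.exp_le_exp]
  nlinarith [Nat.lt_floor_add_one t]

variable {E : Type*} [NormedAddCommGroup E] {B : ℂ → E}

lemma IsSemigroup.continuousOn_comp (hF : IsSemigroup F) (hB : ContinuousOn B disk) {z : ℂ}
    (hz : z ∈ disk) : ContinuousOn (fun t => B (F t z)) (Ici 0) :=
  hB.comp (continuousOn_time hF.continuous hz) fun _ ht => hF.mapsTo _ ht hz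

lemma IsSemigroup.aestronglyMeasurable_comp_sub (hF : IsSemigroup F) (hB : ContinuousOn B disk)
    {z : ℂ} (hz : z ∈ disk) (e : E) :
    AEStronglyMeasurable (fun t => B (F t z) - e) (volume.restrict (Ioi 0)) :=
  (((hF.continuousOn_comp hB hz).sub continuousOn_const).mono
    Ioi_subset_Ici_self).aestronglyMeasurable measurableSet_Ioi

variable [NormedSpace ℂ E] [CompleteSpace E]

lemma IsAttractiveFixedPoint.exists_norm_comp_sub_le_exp (hF : IsSemigroup F)
    (hz₀ : IsAttractiveFixedPoint F z₀) (hB : DifferentiableOn ℂ B disk) {K : Set ℂ}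
    (hK : IsCompact K) (hKd : K ⊆ disk) :
    ∃ C c, 0 < c ∧ ∀ t, 0 ≤ t → ∀ z ∈ K, ‖B (F t z) - B z₀‖ ≤ C * Real.exp (-c * t) := by
  obtain ⟨r, hr, hKr⟩ : ∃ r ∈ Ioo (0 : ℝ) 1, diskInvolution z₀ '' K ⊆ Metric.ball 0 r :=
    exists_pos_lt_subset_ball one_pos
      (hK.image_of_continuousOn
        ((differentiableOn_diskInvolution hz₀.mem).continuousOn.mono hKd)).isClosed
      ((mapsTo_diskInvolution hz₀.mem).mono_left hKd).image_subset
  have hr' := Ioo_subset_Ico_self hr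
  obtain ⟨q, hq, hpow⟩ := hz₀.exists_norm_diskInvolution_le_pow hF hr'
  obtain ⟨L, hL, hB⟩ := exists_norm_sub_le_mul_norm_diskInvolution hB hz₀.mem hr'
  refine ⟨L * Real.exp (1 - q), 1 - q, sub_pos.2 hq.2, fun t ht z hz => ?_⟩
  have hzr : ‖diskInvolution z₀ z‖ ≤ r :=
    (mem_ball_zero_iff.1 (hKr (mem_image_of_mem _ hz))).le
  have hpow := hpow t ht z (hKd hz) hzr
  have hle : ‖diskInvolution z₀ (F t z)‖ ≤ r := hpow.trans
    ((mul_le_of_le_one_left (norm_nonneg _) (pow_le_one₀ hq.1 hq.2.le)).trans hzr)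
  calc ‖B (F t z) - B z₀‖ ≤ L * ‖diskInvolution z₀ (F t z)‖ := hB _ (hF.mapsTo t ht (hKd hz)) hle
    _ ≤ L * q ^ ⌊t⌋₊ := by
        gcongr
        exact hpow.trans (mul_le_of_le_one_right (pow_nonneg hq.1 _) (hzr.trans hr.2.le))
    _ ≤ L * (Real.exp (1 - q) * Real.exp (-(1 - q) * t)) := by
        gcongr
        exact pow_floor_le_exp hq.1 hq.2.le t
    _ = L * Real.exp (1 - q) * Real.exp (-(1 - q) * t) := (mul_assoc _ _ _).symm

lemma IsAttractiveFixedPoint.exists_integrableOn_bound_comp_sub (hF : IsSemigroup F)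
    (hz₀ : IsAttractiveFixedPoint F z₀) (hB : DifferentiableOn ℂ B disk) {K : Set ℂ}
    (hK : IsCompact K) (hKd : K ⊆ disk) :
    ∃ b : ℝ → ℝ, IntegrableOn b (Ioi 0) ∧
      ∀ᵐ t ∂volume.restrict (Ioi 0), ∀ z ∈ K, ‖B (F t z) - B z₀‖ ≤ b t := by
  obtain ⟨C, c, hc, hle⟩ := hz₀.exists_norm_comp_sub_le_exp hF hB hK hKd
  exact ⟨_, (exp_neg_integrableOn_Ioi 0 hc).const_mul C,
    ae_restrict_of_forall_mem measurableSet_Ioi fun t ht => hle t (le_of_lt ht)⟩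

lemma IsAttractiveFixedPoint.integrableOn_comp_sub (hF : IsSemigroup F)
    (hz₀ : IsAttractiveFixedPoint F z₀) (hB : DifferentiableOn ℂ B disk) {z : ℂ} (hz : z ∈ disk) :
    IntegrableOn (fun t => B (F t z) - B z₀) (Ioi 0) := by
  obtain ⟨b, hb, hle⟩ := hz₀.exists_integrableOn_bound_comp_sub hF hB isCompact_singleton
    (singleton_subset_iff.2 hz)
  exact hb.mono' (hF.aestronglyMeasurable_comp_sub hB.continuousOn hz _)
    (hle.mono fun t ht => ht z rfl)

lemma IsAttractiveFixedPoint.differentiableOn_integral_comp_sub (hF : IsSemigroup F)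
    (hz₀ : IsAttractiveFixedPoint F z₀) (hB : DifferentiableOn ℂ B disk) :
    DifferentiableOn ℂ (fun z => ∫ t in Ioi (0 : ℝ), (B (F t z) - B z₀)) disk := by
  refine differentiableOn_integral_of_dominated_on_compacts isOpen_disk
    (fun z hz => hF.aestronglyMeasurable_comp_sub hB.continuousOn hz _) ?_
    fun K hKd hK => hz₀.exists_integrableOn_bound_comp_sub hF hB hK hKd
  exact ae_restrict_of_forall_mem measurableSet_Ioi fun t ht =>
    (hB.comp (hF.holomorphic t (le_of_lt ht)) (hF.mapsTo t (le_of_lt ht))).sub_const _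

lemma IsAttractiveFixedPoint.integral_comp_sub_shift (hF : IsSemigroup F)
    (hz₀ : IsAttractiveFixedPoint F z₀) (hB : DifferentiableOn ℂ B disk) {t : ℝ} (ht : 0 ≤ t)
    {z : ℂ} (hz : z ∈ disk) :
    ∫ s in Ioi (0 : ℝ), (B (F s z) - B z₀) =
      (∫ s in (0 : ℝ)..t, B (F s z)) - t • B z₀ +
        ∫ s in Ioi (0 : ℝ), (B (F s (F t z)) - B z₀) := by
  have hint : IntegrableOn (fun s => B (F s z) - B z₀) (Ioi 0) := hz₀.integrableOn_comp_sub hF hB hz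
  have hshift : ∫ s in Ioi (0 : ℝ), (B (F s (F t z)) - B z₀) =
      ∫ s in Ioi t, (B (F s z) - B z₀) := by
    have hpre := (measurePreserving_add_right volume t).setIntegral_preimage_emb
      (MeasurableEquiv.addRight t).measurableEmbedding (fun s => B (F s z) - B z₀) (Ioi t)
    rw [← hpre, preimage_add_const_Ioi, sub_self]
    refine setIntegral_congr_fun measurableSet_Ioi fun s (hs : 0 < s) => ?_
    simp only [hF.add s t hs.le ht z hz]
  have hfinite : ∫ s in (0 : ℝ)..t, (B (F s z) - B z₀) =
      (∫ s in (0 : ℝ)..t, B (F s z)) - t • B z₀ := by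
    rw [intervalIntegral.integral_sub ?_ intervalIntegrable_const,
      intervalIntegral.integral_const, sub_zero]
    exact ((hF.continuousOn_comp hB.continuousOn hz).mono
      fun s hs => le_trans (le_min le_rfl ht) hs.1).intervalIntegrable
  rw [hshift, ← hfinite]
  exact (intervalIntegral.integral_interval_add_Ioi hint
    (hint.mono_set (Ioi_subset_Ioi ht))).symm

end ExponentialConvergence

section SemicocycleExponential

variable {F : ℝ → ℂ → ℂ}

lemma IsSemicocycle.hasDerivWithinAt_time {A : Type*} [NormedRing A] [NormedAlgebra ℂ A]
    [CompleteSpace A] {Γ : ℝ → ℂ → A} (hF : IsSemigroup F) (hΓ : IsSemicocycle F Γ) {t : ℝ}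
    (ht : 0 ≤ t) {z : ℂ} (hz : z ∈ disk) :
    HasDerivWithinAt (fun s => Γ s z) (generator Γ (F t z) * Γ t z) (Ici t) t := by
  have htranslate : HasDerivWithinAt (fun s : ℝ => s - t) 1 (Ici t) t :=
    ((hasDerivAt_id t).sub_const t).hasDerivWithinAt
  have hshift := HasDerivWithinAt.scomp_of_eq (h := fun s : ℝ => s - t) (t' := Ici 0) t
    (hΓ.hasDerivWithinAt_generator hF (hF.mapsTo t ht hz)) htranslate
    (fun s (hs : t ≤ s) => sub_nonneg.2 hs) (sub_self t).symm
  rw [one_smul] at hshift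
  refine (hshift.mul_const (Γ t z)).congr_of_mem (fun s (hs : t ≤ s) => ?_) self_mem_Ici
  rw [Function.comp_apply, hΓ.chain (s - t) t (sub_nonneg.2 hs) ht z hz, sub_add_cancel]

lemma IsSemicocycle.eq_exp_integral {A : Type*} [NormedCommRing A] [NormedAlgebra ℂ A]
    [CompleteSpace A] {Γ : ℝ → ℂ → A} (hF : IsSemigroup F) (hΓ : IsSemicocycle F Γ) {t : ℝ}
    (ht : 0 ≤ t) {z : ℂ} (hz : z ∈ disk) :
    Γ t z = NormedSpace.exp (∫ s in (0 : ℝ)..t, generator Γ (F s z)) := by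
  rw [eq_exp_integral_mul_of_hasDerivWithinAt
    (hF.continuousOn_comp (hΓ.differentiableOn_generator hF).continuousOn hz)
    (continuousOn_time hΓ.continuous hz) (fun s hs => hΓ.hasDerivWithinAt_time hF hs hz) ht,
    hΓ.zero z hz, mul_one]

end SemicocycleExponential

end HolSemicocycle

theorem theorem3p5 {A : Type*} [NormedCommRing A] [NormedAlgebra ℂ A] [NormOneClass A]
    [CompleteSpace A] (F : ℝ → ℂ → ℂ) (hF : HolSemicocycle.IsSemigroup F)
    (z₀ : ℂ) (hz₀ : HolSemicocycle.IsAttractiveFixedPoint F z₀)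
    (Γ : ℝ → ℂ → A) (hΓ : HolSemicocycle.IsSemicocycle F Γ) :
    (∀ z ∈ HolSemicocycle.disk,
      HasDerivWithinAt (fun t : ℝ => Γ t z) (HolSemicocycle.generator Γ z) (Set.Ici 0) 0) ∧
    (∀ z ∈ HolSemicocycle.disk,
      MeasureTheory.IntegrableOn
        (fun t : ℝ => HolSemicocycle.generator Γ (F t z) - HolSemicocycle.generator Γ z₀)
        (Set.Ioi 0)) ∧
    HolSemicocycle.IsLinearization F Γ
      (HolSemicocycle.transferMap F (HolSemicocycle.generator Γ) z₀)
      (HolSemicocycle.generator Γ z₀) := by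
  let _ : NormedAlgebra ℚ A := NormedAlgebra.restrictScalars ℚ ℝ A
  have hB := hΓ.differentiableOn_generator hF
  refine ⟨fun z hz => hΓ.hasDerivWithinAt_generator hF hz,
    fun z hz => hz₀.integrableOn_comp_sub hF hB hz, ?_, ?_, ?_⟩
  · intro z hz
    exact (hasFDerivAt_exp (𝕂 := ℂ)).differentiableAt.comp_differentiableWithinAt z
      (hz₀.differentiableOn_integral_comp_sub hF hB z hz)
  · exact fun z _ => NormedSpace.isUnit_exp _
  · intro t ht z hz
    rw [hΓ.eq_exp_integral hF ht hz, HolSemicocycle.transferMap, HolSemicocycle.transferMap,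
      Ring.inverse_exp, ← NormedSpace.exp_add, ← NormedSpace.exp_add,
      hz₀.integral_comp_sub_shift hF hB ht hz, Complex.coe_smul]
    congr 1
    abel
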